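/- Let $X_1,X_2,\dots$ be i.i.d. random variables on a probability space $(\Omega,P_0)$, uniformly distributed on $[0,1]$ (the null hypothesis of uniformity). For $j\ge 1$ let $\phi_j$ be the $j$-th orthonormal Legendre polynomial on $[0,1]$ (so $\phi_1(x)=\sqrt3(2x-1)$, $\phi_2(x)=\sqrt5(6x^2-6x+1)$, etc.), and for $n,k\ge1$ let $$T_k=T_k(n)=\sum_{j=1}^{k}\Bigl\{\frac1{\sqrt n}\sum_{i=1}^{n}\phi_j(X_i)\Bigr\}^2 .$$ Let $d(n)\ge 1$ be integers and let $\pi(k,n)$ be real penalties such that $\pi(1,n)<\pi(2,n)<\dots<\pi(d(n),n)$ for all sufficiently large $n$ and, for every fixed $j\ge2$, $\pi(j,n)-\pi(1,n)\to\infty$ as $n\to\infty$ through those $n$ with $d(n)\ge j$. Define the selection rule $$S=S(n)=\min\bigl\{k:\ 1\le k\le d(n),\ T_k-\pi(k,n)\ge T_j-\pi(j,n)\ \text{for } j=1,\dots,d(n)\bigr\}$$ and the data-driven test statistic $T_S=T_{S(n)}(n)$. Assume that, for all sufficiently large $n$, $$\pi(k,n)-\pi(1,n)\ge 2k\qquad\text{for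 all } 2\le k\le d(n),$$ and that $$\lim_{n\to\infty}\frac{d(n)\,\pi(d(n),n)}{\sqrt n}=0 .$$ Then $S=O_{P_0}(1)$ and $T_S=O_{P_0}(1)$ as $n\to\infty$; that is, for every $\varepsilon>0$ there is a constant $C$ such that $P_0(S(n)>C)\le\varepsilon$ and $P_0(|T_{S(n)}(n)|>C)\le\varepsilon$ for all sufficiently large $n$. -/

import Mathlib

open MeasureTheory ProbabilityTheory Filter Topology

noncomputable section

namespace NeymanTest

/-- The `j`-th orthonormal Legendre polynomial on `[0,1]`, normalised to have a positive leading
coefficient: `φ₁ x = √3 (2x - 1)`, `φ₂ x = √5 (6x² - 6x + 1)`, and so on. The sign `(-1)^j` is there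
because `Polynomial.shiftedLegendre j` takes the value `1` at `0`. -/
def legendre (j : ℕ) (x : ℝ) : ℝ :=
  (-1) ^ j * √(2 * (j : ℝ) + 1) * Polynomial.aeval x (Polynomial.shiftedLegendre j)

/-- The smooth test statistic with `k` components and sample size `n`,
`T_k = ∑_{j=1}^k { n^{-1/2} ∑_{i=1}^n φ_j(X_i) }²`;
the observations `X_1, …, X_n` are `X 0, …, X (n-1)`. -/
def statistic {Ω : Type*} (X : ℕ → Ω → ℝ) (n k : ℕ) (ω : Ω) : ℝ :=
  ∑ j ∈ Finset.Icc 1 k, (1 / √(n : ℝ) * ∑ i ∈ Finset.range n, legendre j (X i ω)) ^ 2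

/-- Penalties `pen k n` (model dimension `k`, sample size `n`) for the dimensions `1, …, d n`. -/
structure IsPenalty (d : ℕ → ℕ) (pen : ℕ → ℕ → ℝ) : Prop where
  /-- `pen 1 n < pen 2 n < ⋯ < pen (d n) n` (for all large `n`). -/
  strictMono : ∀ᶠ n in atTop, ∀ j k, 1 ≤ j → j < k → k ≤ d n → pen j n < pen k n
  /-- For fixed `j ≥ 2`, `pen j n - pen 1 n → ∞` as `n → ∞` through those `n` with `j ≤ d n`. -/
  tendsto_atTop : ∀ j, 2 ≤ j →
    Tendsto (fun n => pen j n - pen 1 n) (atTop ⊓ 𝓟 {n | j ≤ d n}) atTop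

/-- The selected dimension
`S = min {k : 1 ≤ k ≤ d(n), T_k - pen(k,n) ≥ T_j - pen(j,n) for j = 1, …, d(n)}`;
the set is nonempty as soon as `1 ≤ d n`. -/
def selectionRule {Ω : Type*} (X : ℕ → Ω → ℝ) (d : ℕ → ℕ) (pen : ℕ → ℕ → ℝ)
    (n : ℕ) (ω : Ω) : ℕ :=
  sInf {k : ℕ | 1 ≤ k ∧ k ≤ d n ∧ ∀ j, 1 ≤ j → j ≤ d n →
    statistic X n j ω - pen j n ≤ statistic X n k ω - pen k n}

/-- The data-driven test statistic `T_S`. -/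
def dataDrivenStatistic {Ω : Type*} (X : ℕ → Ω → ℝ) (d : ℕ → ℕ) (pen : ℕ → ℕ → ℝ)
    (n : ℕ) (ω : Ω) : ℝ :=
  statistic X n (selectionRule X d pen n ω) ω

/-- `Z_n = O_P(1)` as `n → ∞`: boundedness in probability. -/
def BoundedInProbability {Ω : Type*} [MeasurableSpace Ω] (P : Measure Ω)
    (Z : ℕ → Ω → ℝ) : Prop :=
  ∀ ε : ℝ, 0 < ε → ∃ C : ℝ, ∀ᶠ n in atTop, P {ω | C < |Z n ω|} ≤ ENNReal.ofReal ε

end NeymanTest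

end

noncomputable section

namespace NeymanTest

/-! If a dimension `k ≥ 2` is selected, comparison with dimension 1 gives `T_k ≥ 2k`, although `T_k`
has mean `k`. Tightness of `S` thus needs one bound on these excesses, uniform over all large `k`.
Split `T_k` into its diagonal `n⁻¹ ∑_i ∑_{j ≤ k} φ_j(X_i)²` and `2/n` times `cross`. The diagonal is
handled pathwise: `sum_legendre_sq_le` dominates `∑_{j ≤ k} φ_j²` by `k` times a fixed function
`arcsineBound` of mean below 1.85, so a single law of large numbers puts the diagonal below `1.85 k`
for all `k ≥ 200` at once. What is left forces `cross` to be of order `n k`. Its second moment is of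
order `n² k` (`integral_cross_sq`), so Chebyshev gives `O(1/k)`, which is not summable. Since `T_k`
increases in `k`, it suffices to look at squares `k = m²` (`exists_cross_ge`), and `∑ 1/m²` has
small tails. Once `S ≤ K` with high probability, monotonicity gives `T_S ≤ T_K`, and Markov's
inequality applies. The analytic core is `sqrt_mul_sum_legendrePoly_sq_le`. The limiting constant
there is `2/π`, while any constant below `4/π` would give a majorant of mean below 2; this leaves
room for the crude value 1.15. -/

/-! ### Ladder relations and the Legendre differential equation -/

open Polynomial in
/-- Relation between the coefficients of consecutive shifted Legendre polynomials. -/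
theorem X_mul_derivative_shiftedLegendre_add (n : ℕ) :
    (X : ℤ[X]) * (derivative (shiftedLegendre (n + 1)) + derivative (shiftedLegendre n)) =
      C ((n : ℤ) + 1) * (shiftedLegendre (n + 1) - shiftedLegendre n) := by
  have key : ∀ k : ℕ, ((n : ℤ) + 1 - k) * ((n + 1).choose k * (n + 1 + k).choose (n + 1)) =
      (n + 1 + k) * (n.choose k * (n + k).choose n) := by
    intro k
    have h1 : ((n : ℤ) + 1 - k) * (n + 1).choose k = (n + 1) * n.choose k := by
      rcases le_or_gt k (n + 1) with h | h
      · have := Nat.choose_mul_succ_eq n k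
        zify [h] at this
        linarith
      · rw [Nat.choose_eq_zero_of_lt h, Nat.choose_eq_zero_of_lt (by omega)]; simp
    have h2 := Nat.add_one_mul_choose_eq (n + k) n
    have h2' : ((n : ℤ) + k + 1) * (n + k).choose n = (n + 1 + k).choose (n + 1) * (n + 1) := by
      rw [show n + 1 + k = n + k + 1 by ring]
      exact_mod_cast h2
    linear_combination (((n + 1 + k).choose (n + 1) : ℕ) : ℤ) * h1 - (n.choose k : ℤ) * h2'
  ext k
  rw [coeff_C_mul, coeff_sub, coeff_shiftedLegendre, coeff_shiftedLegendre]
  cases k with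
  | zero => simp
  | succ k =>
    rw [coeff_X_mul, coeff_add, coeff_derivative, coeff_derivative, coeff_shiftedLegendre,
      coeff_shiftedLegendre]
    have := key (k + 1)
    push_cast at this ⊢
    linear_combination (-(-1 : ℤ) ^ (k + 1)) * this

/-- The Legendre polynomials on `[-1, 1]`, normalised to take the value `1` at `1`. -/
def legendrePoly (n : ℕ) : Polynomial ℝ :=
  ((Polynomial.shiftedLegendre n).map (Int.castRingHom ℝ)).comp
    (Polynomial.C (1 / 2) * (1 - Polynomial.X))

open Polynomial in
theorem eval_legendrePoly (n : ℕ) (t : ℝ) :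
    (legendrePoly n).eval t = aeval ((1 - t) / 2) (shiftedLegendre n) := by
  rw [legendrePoly, eval_comp, eval_map, aeval_def]
  simp only [eval_mul, eval_C, eval_sub, eval_one, eval_X]
  congr 1
  ring

open Polynomial in
theorem legendrePoly_zero : legendrePoly 0 = 1 := by
  simp [legendrePoly, shiftedLegendre]

open Polynomial in
theorem eval_legendrePoly_one (n : ℕ) : (legendrePoly n).eval 1 = 1 := by
  rw [eval_legendrePoly, sub_self, zero_div, ← coeff_zero_eq_aeval_zero', coeff_shiftedLegendre]
  simp

open Polynomial in
theorem eval_legendrePoly_neg (n : ℕ) (t : ℝ) :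
    (legendrePoly n).eval (-t) = (-1) ^ n * (legendrePoly n).eval t := by
  rw [eval_legendrePoly, eval_legendrePoly, shiftedLegendre_eval_symm]
  congr 2
  congr 1
  ring

open Polynomial in
theorem derivative_legendrePoly_neg (n : ℕ) (t : ℝ) :
    (derivative (legendrePoly n)).eval (-t) =
      -(-1) ^ n * (derivative (legendrePoly n)).eval t := by
  have h1 := ((legendrePoly n).hasDerivAt (-t)).scomp t (hasDerivAt_neg t)
  have h2 := ((legendrePoly n).hasDerivAt t).const_mul ((-1 : ℝ) ^ n)
  have h3 : ((fun x => eval x (legendrePoly n)) ∘ Neg.neg) =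
      fun y => (-1) ^ n * eval y (legendrePoly n) := by
    funext y; exact eval_legendrePoly_neg n y
  rw [h3] at h1
  have := h1.unique h2
  simp at this
  linarith

open Polynomial in
theorem one_sub_mul_derivative_legendrePoly_add (n : ℕ) (t : ℝ) :
    (1 - t) * ((derivative (legendrePoly (n + 1))).eval t + (derivative (legendrePoly n)).eval t) =
      -(n + 1) * ((legendrePoly (n + 1)).eval t - (legendrePoly n).eval t) := by
  have h := congrArg (fun p : ℤ[X] => (p.map (Int.castRingHom ℝ)).eval ((1 - t) / 2))
    (X_mul_derivative_shiftedLegendre_add n)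
  simp only [Polynomial.map_mul, Polynomial.map_add, Polynomial.map_sub, map_X, map_C, eval_mul,
    eval_add, eval_sub, eval_X, eval_C, ← derivative_map] at h
  simp only [legendrePoly, derivative_comp, eval_mul, eval_comp, derivative_mul, derivative_C,
    derivative_sub, derivative_one, derivative_X, eval_add, eval_sub, eval_C, eval_X, eval_one,
    eval_zero]
  rw [show (1 / 2 : ℝ) * (1 - t) = (1 - t) / 2 by ring]
  simp only [eq_intCast, Int.cast_add, Int.cast_natCast, Int.cast_one] at h
  linear_combination (-1) * h

open Polynomial in
-- The reflection `t ↦ -t` of the preceding relation, by parity.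
theorem one_add_mul_derivative_legendrePoly_sub (n : ℕ) (t : ℝ) :
    (1 + t) * ((derivative (legendrePoly (n + 1))).eval t - (derivative (legendrePoly n)).eval t) =
      (n + 1) * ((legendrePoly (n + 1)).eval t + (legendrePoly n).eval t) := by
  have h := one_sub_mul_derivative_legendrePoly_add n (-t)
  simp only [eval_legendrePoly_neg, derivative_legendrePoly_neg, pow_succ] at h
  have h4 : ((-1 : ℝ) ^ n) * (-1) ^ n = 1 := by rw [← mul_pow]; simp
  have := congrArg (fun z => (-1 : ℝ) ^ n * z) h
  beta_reduce at this
  linear_combination this - ((1 + t) * ((derivative (legendrePoly (n + 1))).eval t -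
    (derivative (legendrePoly n)).eval t) -
      (n + 1) * ((legendrePoly (n + 1)).eval t + (legendrePoly n).eval t)) * h4

open Polynomial in
theorem mul_derivative_legendrePoly_succ (n : ℕ) (t : ℝ) :
    (1 - t ^ 2) * (derivative (legendrePoly (n + 1))).eval t =
      (n + 1) * ((legendrePoly n).eval t - t * (legendrePoly (n + 1)).eval t) := by
  linear_combination (1 + t) / 2 * one_sub_mul_derivative_legendrePoly_add n t +
    (1 - t) / 2 * one_add_mul_derivative_legendrePoly_sub n t

open Polynomial in
theorem mul_derivative_legendrePoly (n : ℕ) (t : ℝ) :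
    (1 - t ^ 2) * (derivative (legendrePoly n)).eval t =
      (n + 1) * (t * (legendrePoly n).eval t - (legendrePoly (n + 1)).eval t) := by
  linear_combination (1 + t) / 2 * one_sub_mul_derivative_legendrePoly_add n t -
    (1 - t) / 2 * one_add_mul_derivative_legendrePoly_sub n t

open Polynomial in
/-- The Legendre differential equation in self-adjoint form. -/
theorem derivative_mul_derivative_legendrePoly (n : ℕ) :
    derivative ((1 - X ^ 2) * derivative (legendrePoly n)) =
      C (-((n : ℝ) * (n + 1))) * legendrePoly n := by
  have ha : (1 - X ^ 2 : ℝ[X]) * derivative (legendrePoly (n + 1)) =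
      C ((n : ℝ) + 1) * (legendrePoly n - X * legendrePoly (n + 1)) :=
    Polynomial.funext fun t => by simpa using mul_derivative_legendrePoly_succ n t
  have hb : (1 - X ^ 2 : ℝ[X]) * derivative (legendrePoly n) =
      C ((n : ℝ) + 1) * (X * legendrePoly n - legendrePoly (n + 1)) :=
    Polynomial.funext fun t => by simpa using mul_derivative_legendrePoly n t
  have hne : (1 - X ^ 2 : ℝ[X]) ≠ 0 := by
    intro h
    have := congrArg (eval 0) h
    simp at this
  apply mul_left_cancel₀ hne
  rw [hb, derivative_C_mul, derivative_sub, derivative_mul, derivative_X]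
  have hc : (C (-((n : ℝ) * (n + 1))) : ℝ[X]) = -(C ((n : ℝ) + 1) * (C ((n : ℝ) + 1) - 1)) := by
    rw [← C_1, ← C_sub, ← C_mul, ← C_neg]
    congr 1; ring
  rw [hc]
  linear_combination C ((n : ℝ) + 1) * X * hb - C ((n : ℝ) + 1) * ha

open Polynomial in
theorem legendrePoly_ode (n : ℕ) (t : ℝ) :
    (1 - t ^ 2) * (derivative (derivative (legendrePoly n))).eval t =
      2 * t * (derivative (legendrePoly n)).eval t - n * (n + 1) * (legendrePoly n).eval t := by
  have h := congrArg (eval t) (derivative_mul_derivative_legendrePoly n)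
  simp only [derivative_mul, derivative_sub, derivative_one, derivative_X_pow, eval_mul, eval_add,
    eval_sub, eval_zero, eval_one, eval_pow, eval_X, eval_C] at h
  norm_num at h
  linear_combination h

/-! ### The Christoffel–Darboux kernel on the diagonal -/

open Polynomial in
-- By the ladder relations, `1 - t²` times either side equals `(n+1)² (p² - 2tpq + q²)`, with `p`,
-- `q` the values of the two polynomials; this is symmetric in `p` and `q`. The points `t² = 1` need
-- a separate argument.
theorem legendrePoly_succ_energy (n : ℕ) (t : ℝ) :
    (n + 1) ^ 2 * (legendrePoly (n + 1)).eval t ^ 2 +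
        (1 - t ^ 2) * (derivative (legendrePoly (n + 1))).eval t ^ 2 =
      (n + 1) ^ 2 * (legendrePoly n).eval t ^ 2 +
        (1 - t ^ 2) * (derivative (legendrePoly n)).eval t ^ 2 := by
  have ha := mul_derivative_legendrePoly_succ n t
  have hb := mul_derivative_legendrePoly n t
  generalize (legendrePoly n).eval t = p at *
  generalize (legendrePoly (n + 1)).eval t = q at *
  generalize (derivative (legendrePoly n)).eval t = p' at *
  generalize (derivative (legendrePoly (n + 1))).eval t = q' at *
  by_cases hw : 1 - t ^ 2 = 0
  · rw [hw] at ha ⊢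
    have hn : (n : ℝ) + 1 ≠ 0 := by positivity
    have h1 : p - t * q = 0 := by
      rw [zero_mul] at ha
      exact (mul_eq_zero.mp ha.symm).resolve_left hn
    have h2 : p = t * q := by linarith
    rw [h2]
    linear_combination (n + 1) ^ 2 * q ^ 2 * hw
  · apply mul_left_cancel₀ hw
    linear_combination ((1 - t ^ 2) * q' + (n + 1) * (p - t * q)) * ha -
      ((1 - t ^ 2) * p' + (n + 1) * (t * p - q)) * hb

open Polynomial in
/-- Closed form of the Christoffel–Darboux kernel of the Legendre polynomials on the diagonal. -/
theorem sum_legendrePoly_sq (k : ℕ) (t : ℝ) :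
    ∑ j ∈ Finset.range (k + 1), (2 * (j : ℝ) + 1) * (legendrePoly j).eval t ^ 2 =
      (k + 1) ^ 2 * (legendrePoly k).eval t ^ 2 +
        (1 - t ^ 2) * (derivative (legendrePoly k)).eval t ^ 2 := by
  induction k with
  | zero => simp [legendrePoly_zero]
  | succ k ih =>
    rw [Finset.sum_range_succ, ih]
    -- The new summand fits because `(k+1)² + (2(k+1)+1) = (k+2)²`.
    have := legendrePoly_succ_energy k t
    push_cast
    linear_combination -this

open Polynomial in
-- By the differential equation the left side has derivative `2t P_n'(t)² ≥ 0`, so it is largest at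
-- `t = 1`.
theorem legendrePoly_energy_le (n : ℕ) {t : ℝ} (ht : t ∈ Set.Icc (0 : ℝ) 1) :
    n * (n + 1) * (legendrePoly n).eval t ^ 2 +
      (1 - t ^ 2) * (derivative (legendrePoly n)).eval t ^ 2 ≤ n * (n + 1) := by
  set q : ℝ[X] := C ((n : ℝ) * (n + 1)) * legendrePoly n ^ 2 +
    (1 - X ^ 2) * derivative (legendrePoly n) ^ 2 with hq
  have hd : ∀ s, (derivative q).eval s = 2 * s * (derivative (legendrePoly n)).eval s ^ 2 := by
    intro s
    have h := legendrePoly_ode n s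
    rw [hq]
    simp only [derivative_add, derivative_mul, derivative_C, derivative_pow, derivative_sub,
      derivative_one, derivative_X, eval_add, eval_mul, eval_C, eval_pow, eval_sub, eval_X,
      eval_one, eval_zero]
    norm_num
    linear_combination 2 * (derivative (legendrePoly n)).eval s * h
  have hmono : MonotoneOn (fun s => q.eval s) (Set.Icc 0 1) := by
    apply monotoneOn_of_deriv_nonneg (convex_Icc 0 1) q.continuous.continuousOn
      q.differentiable.differentiableOn
    intro s hs
    rw [interior_Icc] at hs
    rw [Polynomial.deriv, hd]
    have := hs.1.le
    positivity
  have := hmono ht (Set.right_mem_Icc.mpr zero_le_one) ht.2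
  simpa [hq, eval_legendrePoly_one] using this

open Polynomial in
theorem sum_legendrePoly_sq_le (k : ℕ) {t : ℝ} (ht : t ∈ Set.Icc (0 : ℝ) 1) :
    ∑ j ∈ Finset.range (k + 1), (2 * (j : ℝ) + 1) * (legendrePoly j).eval t ^ 2 ≤
      ((k : ℝ) + 1) ^ 2 := by
  have hw : 0 ≤ 1 - t ^ 2 := by nlinarith [ht.1, ht.2]
  rw [sum_legendrePoly_sq]
  rcases Nat.eq_zero_or_pos k with rfl | hk
  · simp [legendrePoly_zero]
  have hk' : (0 : ℝ) < k := by exact_mod_cast hk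
  have h := legendrePoly_energy_le k ht
  have h2 : 0 ≤ (1 - t ^ 2) * (derivative (legendrePoly k)).eval t ^ 2 := by positivity
  have h3 : (legendrePoly k).eval t ^ 2 ≤ 1 := by
    by_contra hc
    push Not at hc
    nlinarith [mul_pos hk' (by positivity : (0 : ℝ) < k + 1)]
  nlinarith

/-! ### Sonin's function and the uniform kernel bound -/

/-- The Sonin function of the Legendre differential equation in Liouville normal form. -/
def sonin (n : ℕ) (t : ℝ) : ℝ :=
  √(1 - t ^ 2) * ((legendrePoly n).eval t ^ 2 +
    (2 * (1 - t ^ 2) * (Polynomial.derivative (legendrePoly n)).eval t -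
      t * (legendrePoly n).eval t) ^ 2 / ((2 * (n : ℝ) + 1) ^ 2 * (1 - t ^ 2) + 1))

open Polynomial in
-- With `t = cos θ`, `u = √(sin θ) P_n(cos θ)` solves `u'' + q u = 0`, where `q = (n + 1/2)² + 1/(4
-- sin² θ)`. The function `sonin` is `u² + u'²/q`, whose `θ`-derivative `-q' u'²/q²` has the sign of
-- `-q'`.
theorem hasDerivAt_sonin (n : ℕ) {t : ℝ} (ht : 0 < 1 - t ^ 2) :
    HasDerivAt (sonin n)
      (-2 * t * (2 * (1 - t ^ 2) * (derivative (legendrePoly n)).eval t -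
        t * (legendrePoly n).eval t) ^ 2 /
        (√(1 - t ^ 2) * ((2 * (n : ℝ) + 1) ^ 2 * (1 - t ^ 2) + 1) ^ 2)) t := by
  have hw : HasDerivAt (fun t : ℝ => 1 - t ^ 2) (-(2 * t)) t := by
    simpa using (hasDerivAt_pow 2 t).const_sub 1
  have hs := hw.sqrt ht.ne'
  have hp := (legendrePoly n).hasDerivAt t
  have hp' := (derivative (legendrePoly n)).hasDerivAt t
  have hD : (2 * (n : ℝ) + 1) ^ 2 * (1 - t ^ 2) + 1 ≠ 0 := by positivity
  have ha : HasDerivAt (fun t => 2 * (1 - t ^ 2) * (derivative (legendrePoly n)).eval t -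
      t * (legendrePoly n).eval t) (-(2 * n * (n + 1) + 1) * (legendrePoly n).eval t -
        t * (derivative (legendrePoly n)).eval t) t := by
    refine (((hw.const_mul 2).mul hp').sub ((hasDerivAt_id t).mul hp)).congr_deriv ?_
    simp only [id]
    linear_combination 2 * legendrePoly_ode n t
  have hden := (hw.const_mul ((2 * (n : ℝ) + 1) ^ 2)).add_const 1
  have hV := hs.mul ((hp.pow 2).add ((ha.pow 2).div hden hD))
  have hsq : √(1 - t ^ 2) ^ 2 = 1 - t ^ 2 := Real.sq_sqrt ht.le
  have hs0 : √(1 - t ^ 2) ≠ 0 := (Real.sqrt_pos.mpr ht).ne'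
  refine (hV.congr_deriv ?_).congr_of_eventuallyEq (Eventually.of_forall fun x => rfl)
  simp only [Pi.add_apply, Pi.pow_apply, Pi.div_apply]
  generalize (legendrePoly n).eval t = p at *
  generalize (derivative (legendrePoly n)).eval t = p' at *
  rw [← hsq] at hD ⊢
  set s := √(1 - t ^ 2)
  -- Trading `p'` for the numerator `a` leaves a rational identity modulo `s² = 1 - t²`.
  obtain ⟨a, ha⟩ : ∃ a, p' = (a + t * p) / (2 * s ^ 2) :=
    ⟨2 * s ^ 2 * p' - t * p, by field_simp; ring⟩
  have ha' : 2 * s ^ 2 * p' - t * p = a := by rw [ha]; field_simp; ring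
  rw [ha', ha]
  rw [Real.sqrt_sq (Real.sqrt_nonneg _)]
  field_simp
  push_cast
  linear_combination -2 * s ^ 2 * (s ^ 2 * (2 * (n : ℝ) + 1) ^ 2 + 1) * a * p * hsq

theorem sonin_le (n : ℕ) {t : ℝ} (ht : t ∈ Set.Ico (0 : ℝ) 1) : sonin n t ≤ sonin n 0 := by
  have hpos : ∀ s ∈ Set.Ico (0 : ℝ) 1, 0 < 1 - s ^ 2 := fun s hs => by nlinarith [hs.1, hs.2]
  have hanti : AntitoneOn (sonin n) (Set.Ico 0 1) := by
    apply antitoneOn_of_deriv_nonpos (convex_Ico 0 1)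
    · exact fun s hs => (hasDerivAt_sonin n (hpos s hs)).continuousAt.continuousWithinAt
    · intro s hs
      exact (hasDerivAt_sonin n
        (hpos s (interior_subset hs))).differentiableAt.differentiableWithinAt
    · intro s hs
      have hs' := interior_subset hs
      rw [(hasDerivAt_sonin n (hpos s hs')).deriv]
      apply div_nonpos_of_nonpos_of_nonneg
      · nlinarith [mul_nonneg hs'.1 (sq_nonneg (2 * (1 - s ^ 2) *
          (Polynomial.derivative (legendrePoly n)).eval s - s * (legendrePoly n).eval s))]
      · positivity
  exact hanti (Set.left_mem_Ico.mpr zero_lt_one) ht ht.1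

open Polynomial in
theorem derivative_legendrePoly_succ_zero (n : ℕ) :
    (derivative (legendrePoly (n + 1))).eval 0 = (n + 1) * (legendrePoly n).eval 0 := by
  simpa using mul_derivative_legendrePoly_succ n 0

open Polynomial in
theorem legendrePoly_add_two_eval_zero (n : ℕ) :
    ((n : ℝ) + 2) * (legendrePoly (n + 2)).eval 0 = -((n + 1) * (legendrePoly n).eval 0) := by
  have h := mul_derivative_legendrePoly (n + 1) 0
  rw [derivative_legendrePoly_succ_zero] at h
  push_cast at h
  linear_combination h

theorem legendrePoly_odd_eval_zero (m : ℕ) : (legendrePoly (2 * m + 1)).eval 0 = 0 := by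
  have h := eval_legendrePoly_neg (2 * m + 1) 0
  rw [neg_zero, pow_succ, pow_mul] at h
  norm_num at h
  linarith

/-- A Wallis-type bound: the form `3m + 1` is stable under the two-step recursion at 0, since
`(2m+1)²(3m+4) ≤ (2m+2)²(3m+1)`. -/
theorem legendrePoly_even_eval_zero_sq_le (m : ℕ) :
    (legendrePoly (2 * m)).eval 0 ^ 2 ≤ 1 / (3 * m + 1) := by
  induction m with
  | zero => simp [legendrePoly_zero]
  | succ m ih =>
    have h := legendrePoly_add_two_eval_zero (2 * m)
    rw [show 2 * (m + 1) = 2 * m + 2 by ring]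
    rw [le_div_iff₀ (by positivity)] at ih ⊢
    push_cast at h ⊢
    generalize (legendrePoly (2 * m)).eval 0 = p at *
    generalize (legendrePoly (2 * m + 2)).eval 0 = q at *
    have hm : (0 : ℝ) ≤ m := by positivity
    have h2 : (2 * (m : ℝ) + 2) ^ 2 * q ^ 2 = (2 * m + 1) ^ 2 * p ^ 2 := by
      linear_combination ((2 * (m : ℝ) + 2) * q - (2 * m + 1) * p) * h
    have h3 : (2 * (m : ℝ) + 1) ^ 2 * (3 * (m + 1) + 1) ≤ (2 * m + 2) ^ 2 * (3 * m + 1) := by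
      nlinarith
    have h4 : (0 : ℝ) < (2 * m + 2) ^ 2 := by positivity
    refine le_of_mul_le_mul_left ?_ h4
    calc (2 * (m : ℝ) + 2) ^ 2 * (q ^ 2 * (3 * (m + 1) + 1))
        = p ^ 2 * ((2 * m + 1) ^ 2 * (3 * (m + 1) + 1)) := by
          linear_combination (3 * (m + 1) + 1) * h2
      _ ≤ p ^ 2 * ((2 * m + 2) ^ 2 * (3 * m + 1)) := by gcongr
      _ = (2 * m + 2) ^ 2 * (p ^ 2 * (3 * m + 1)) := by ring
      _ ≤ (2 * m + 2) ^ 2 * 1 := by gcongr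

/-- At 0 the derivative of `P_k` is `k P_{k-1}(0)`, so the value is at most `P_k(0)² + P_{k-1}(0)²`,
and parity kills one of the two terms. -/
theorem sonin_zero_le {k : ℕ} (hk : 1 ≤ k) : sonin k 0 ≤ 2 / (3 * k - 1) := by
  have hk' : (1 : ℝ) ≤ k := by exact_mod_cast hk
  obtain ⟨n, rfl⟩ : ∃ n, k = n + 1 := ⟨k - 1, by omega⟩
  have h1 : sonin (n + 1) 0 ≤ (legendrePoly (n + 1)).eval 0 ^ 2 + (legendrePoly n).eval 0 ^ 2 := by
    rw [sonin, derivative_legendrePoly_succ_zero]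
    norm_num
    rw [div_le_iff₀ (by positivity)]
    nlinarith [mul_nonneg (sq_nonneg ((legendrePoly n).eval 0)) (by positivity : (0 : ℝ) ≤ n)]
  refine h1.trans ?_
  rcases Nat.even_or_odd' n with ⟨m, rfl | rfl⟩
  · rw [legendrePoly_odd_eval_zero]
    have := legendrePoly_even_eval_zero_sq_le m
    refine le_trans (by linarith) (this.trans ?_)
    have hm : (0 : ℝ) ≤ m := by positivity
    push_cast
    rw [div_le_div_iff₀ (by positivity) (by linarith)]
    linarith
  · rw [legendrePoly_odd_eval_zero]
    have := legendrePoly_even_eval_zero_sq_le (m + 1)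
    rw [show 2 * m + 1 + 1 = 2 * (m + 1) by ring]
    refine le_trans (by linarith) (this.trans ?_)
    have hm : (0 : ℝ) ≤ m := by positivity
    push_cast
    rw [div_le_div_iff₀ (by positivity) (by linarith)]
    linarith

open Polynomial in
-- Near the endpoint the trivial bound `(k+1)²` gives about `1.12 k`; elsewhere the Sonin bound
-- gives about `1.7 · (2/3) k`. The condition `k ≥ 200` absorbs the lower-order terms.
theorem sqrt_mul_sum_legendrePoly_sq_le_of_nonneg {k : ℕ} (hk : 200 ≤ k) {t : ℝ}
    (ht : t ∈ Set.Ico (0 : ℝ) 1) :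
    √(1 - t ^ 2) * ∑ j ∈ Finset.range (k + 1), (2 * (j : ℝ) + 1) * (legendrePoly j).eval t ^ 2 ≤
      1.15 * k := by
  have hk' : (200 : ℝ) ≤ k := by exact_mod_cast hk
  have hw : 0 < 1 - t ^ 2 := by nlinarith [ht.1, ht.2]
  set w := 1 - t ^ 2 with hwdef
  rcases le_total ((2 * (k : ℝ) + 1) ^ 2 * w) 5 with h | h
  · have hK := sum_legendrePoly_sq_le k ⟨ht.1, ht.2.le⟩
    have hs : (2 * (k : ℝ) + 1) * √w ≤ 2.24 := by
      apply le_of_sq_le_sq _ (by norm_num)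
      rw [mul_pow, Real.sq_sqrt hw.le]
      linarith
    have hs' : √w ≤ 2.24 / (2 * k + 1) := by
      rw [le_div_iff₀ (by positivity)]; linarith
    calc _ ≤ 2.24 / (2 * (k : ℝ) + 1) * (k + 1) ^ 2 := by gcongr
      _ ≤ 1.15 * k := by
        rw [div_mul_eq_mul_div, div_le_iff₀ (by positivity)]
        nlinarith
  · have hV := (sonin_le k ht).trans (sonin_zero_le (by omega))
    rw [sonin, ← hwdef] at hV
    rw [sum_legendrePoly_sq, ← hwdef]
    generalize (legendrePoly k).eval t = p at *
    generalize (derivative (legendrePoly k)).eval t = p' at *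
    set a := 2 * w * p' - t * p with ha
    set D := (2 * (k : ℝ) + 1) ^ 2 * w + 1 with hD
    have hDpos : 0 < D := by positivity
    have hB : a ^ 2 = D * (a ^ 2 / D) := by field_simp
    have hB0 : 0 ≤ a ^ 2 / D := by positivity
    -- The threshold 5 balances both coefficients: `1.4 · 1.2 = 1.68` for `a²/D`, and `1 + 3.5/5 =
    -- 1.7` for `p²`.
    have key : (k + 1) ^ 2 * p ^ 2 + w * p' ^ 2 ≤ 1.7 * (k + 1) ^ 2 * (p ^ 2 + a ^ 2 / D) := by
      have h1 : 4 * w * (w * p' ^ 2) ≤ 1.4 * a ^ 2 + 3.5 * p ^ 2 := by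
        have : 2 * w * p' = a + t * p := by rw [ha]; ring
        have h2 : 4 * w * (w * p' ^ 2) = (a + t * p) ^ 2 := by rw [← this]; ring
        rw [h2]
        nlinarith [sq_nonneg (0.4 * a - t * p), mul_nonneg hw.le (sq_nonneg p)]
      rw [hB] at h1
      generalize a ^ 2 / D = B at *
      have h3 : (2 * (k : ℝ) + 1) ^ 2 ≤ 4 * (k + 1) ^ 2 := by nlinarith
      refine le_of_mul_le_mul_left ?_ (by positivity : 0 < 4 * w)
      have h4 : (5 : ℝ) ≤ 4 * (k + 1) ^ 2 * w := h.trans (by gcongr)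
      have h5 : D ≤ 1.2 * (4 * (k + 1) ^ 2 * w) := by
        have := mul_le_mul_of_nonneg_right h3 hw.le
        rw [hD]; linarith
      have h6 := mul_le_mul_of_nonneg_right h5 hB0
      have h7 := mul_le_mul_of_nonneg_right h4 (sq_nonneg p)
      nlinarith [mul_nonneg (mul_nonneg (sq_nonneg ((k : ℝ) + 1)) hw.le) hB0]
    calc _ ≤ √w * (1.7 * (k + 1) ^ 2 * (p ^ 2 + a ^ 2 / D)) := by gcongr
      _ = 1.7 * (k + 1) ^ 2 * (√w * (p ^ 2 + a ^ 2 / D)) := by ring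
      _ ≤ 1.7 * (k + 1) ^ 2 * (2 / (3 * k - 1)) := by gcongr
      _ ≤ 1.15 * k := by
        rw [mul_div_assoc', div_le_iff₀ (by linarith)]
        nlinarith

theorem sqrt_mul_sum_legendrePoly_sq_le {k : ℕ} (hk : 200 ≤ k) {t : ℝ}
    (ht : t ∈ Set.Ioo (-1 : ℝ) 1) :
    √(1 - t ^ 2) * ∑ j ∈ Finset.range (k + 1), (2 * (j : ℝ) + 1) * (legendrePoly j).eval t ^ 2 ≤
      1.15 * k := by
  rcases le_total 0 t with h | h
  · exact sqrt_mul_sum_legendrePoly_sq_le_of_nonneg hk ⟨h, ht.2⟩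
  · have := sqrt_mul_sum_legendrePoly_sq_le_of_nonneg hk (t := -t) ⟨by linarith, by linarith [ht.1]⟩
    simpa [eval_legendrePoly_neg, mul_pow, ← pow_mul, mul_comm _ 2] using this

/-! ### Orthogonality and norms -/

open Polynomial in
theorem integral_derivative_one_sub_X_sq_mul (q : ℝ[X]) :
    ∫ t in (-1 : ℝ)..1, (derivative ((1 - X ^ 2) * q)).eval t = 0 := by
  rw [intervalIntegral.integral_eq_sub_of_hasDerivAt
    (fun t _ => ((1 - X ^ 2) * q).hasDerivAt t) ((Polynomial.continuous _).intervalIntegrable _ _)]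
  simp

open Polynomial in
-- Sturm–Liouville argument: the weighted Wronskian vanishes at `±1`, and its derivative is the
-- product times the difference of eigenvalues.
theorem integral_legendrePoly_mul_of_ne {i j : ℕ} (hij : i ≠ j) :
    ∫ t in (-1 : ℝ)..1, (legendrePoly i).eval t * (legendrePoly j).eval t = 0 := by
  have h := integral_derivative_one_sub_X_sq_mul
    (derivative (legendrePoly i) * legendrePoly j - derivative (legendrePoly j) * legendrePoly i)
  have hd : derivative ((1 - X ^ 2) * (derivative (legendrePoly i) * legendrePoly j -
      derivative (legendrePoly j) * legendrePoly i)) =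
      C ((j : ℝ) * (j + 1) - i * (i + 1)) * (legendrePoly i * legendrePoly j) := by
    have e : (1 - X ^ 2 : ℝ[X]) * (derivative (legendrePoly i) * legendrePoly j -
        derivative (legendrePoly j) * legendrePoly i) =
        ((1 - X ^ 2) * derivative (legendrePoly i)) * legendrePoly j -
          ((1 - X ^ 2) * derivative (legendrePoly j)) * legendrePoly i := by ring
    rw [e, derivative_sub, derivative_mul (f := (1 - X ^ 2) * derivative (legendrePoly i)),
      derivative_mul (f := (1 - X ^ 2) * derivative (legendrePoly j)),
      derivative_mul_derivative_legendrePoly, derivative_mul_derivative_legendrePoly]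
    simp only [C_neg, C_sub]
    ring
  rw [hd] at h
  simp only [eval_mul, eval_C] at h
  rw [intervalIntegral.integral_const_mul] at h
  refine (mul_eq_zero.mp h).resolve_left fun h0 => hij ?_
  have h1 : ((j : ℝ) - i) * (i + j + 1) = 0 := by linear_combination h0
  rcases mul_eq_zero.mp h1 with h2 | h2
  · exact_mod_cast (sub_eq_zero.mp h2).symm
  · exact absurd h2 (by positivity)

open Polynomial in
theorem integral_one_sub_sq_mul_derivative_legendrePoly_sq (n : ℕ) :
    ∫ t in (-1 : ℝ)..1, (1 - t ^ 2) * (derivative (legendrePoly n)).eval t ^ 2 =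
      n * (n + 1) * ∫ t in (-1 : ℝ)..1, (legendrePoly n).eval t ^ 2 := by
  have h := integral_derivative_one_sub_X_sq_mul (derivative (legendrePoly n) * legendrePoly n)
  rw [← mul_assoc, derivative_mul, derivative_mul_derivative_legendrePoly] at h
  simp only [eval_add, eval_mul, eval_C, eval_sub, eval_one, eval_pow, eval_X] at h
  rw [intervalIntegral.integral_congr (g := fun t => (1 - t ^ 2) *
      (derivative (legendrePoly n)).eval t ^ 2 - n * (n + 1) * (legendrePoly n).eval t ^ 2)
      (fun t _ => by ring), intervalIntegral.integral_sub, intervalIntegral.integral_const_mul] at h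
  · linarith
  · exact Continuous.intervalIntegrable (by fun_prop) _ _
  · exact Continuous.intervalIntegrable (by fun_prop) _ _

open Polynomial in
-- Integrating `legendrePoly_succ_energy`, with derivative terms removed by parts, gives `(2n+3)
-- I_{n+1} = (2n+1) I_n`.
theorem integral_legendrePoly_sq (n : ℕ) :
    ∫ t in (-1 : ℝ)..1, (legendrePoly n).eval t ^ 2 = 2 / (2 * n + 1) := by
  induction n with
  | zero => simp [legendrePoly_zero]; norm_num
  | succ n ih =>
    have h := intervalIntegral.integral_congr (μ := volume) (a := -1) (b := 1)
      fun t _ => legendrePoly_succ_energy n t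
    rw [intervalIntegral.integral_add, intervalIntegral.integral_add,
      intervalIntegral.integral_const_mul, intervalIntegral.integral_const_mul,
      integral_one_sub_sq_mul_derivative_legendrePoly_sq,
      integral_one_sub_sq_mul_derivative_legendrePoly_sq, ih] at h
    · have hn : (0 : ℝ) < n + 1 := by positivity
      generalize ∫ t in (-1 : ℝ)..1, (legendrePoly (n + 1)).eval t ^ 2 = I at *
      push_cast at h ⊢
      field_simp at h ⊢
      apply mul_left_cancel₀ hn.ne'
      nlinarith
    all_goals exact Continuous.intervalIntegrable (by fun_prop) _ _

/-! ### Transfer to `[0,1]` and the arcsine majorant -/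

theorem legendre_eq (j : ℕ) (x : ℝ) :
    legendre j x = √(2 * (j : ℝ) + 1) * (legendrePoly j).eval (2 * x - 1) := by
  have h4 : ((-1 : ℝ) ^ j) * (-1) ^ j = 1 := by rw [← mul_pow]; simp
  rw [legendre, Polynomial.shiftedLegendre_eval_symm, eval_legendrePoly,
    show (1 - (2 * x - 1)) / 2 = 1 - x by ring]
  linear_combination (√(2 * (j : ℝ) + 1) *
    Polynomial.aeval (1 - x) (Polynomial.shiftedLegendre j)) * h4

theorem continuous_legendre (j : ℕ) : Continuous (legendre j) := by
  unfold legendre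
  fun_prop

theorem legendre_zero (x : ℝ) : legendre 0 x = 1 := by
  simp [legendre_eq, legendrePoly_zero]

/-- The functions `legendre j` are orthonormal in `L²(0, 1)`. -/
theorem integral_legendre_mul_legendre (i j : ℕ) :
    ∫ x in (0 : ℝ)..1, legendre i x * legendre j x = if i = j then 1 else 0 := by
  have e : ∀ x, legendre i x * legendre j x = (√(2 * (i : ℝ) + 1) * √(2 * (j : ℝ) + 1)) *
      ((legendrePoly i).eval (2 * x - 1) * (legendrePoly j).eval (2 * x - 1)) := fun x => by
    rw [legendre_eq, legendre_eq, mul_mul_mul_comm]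
  simp_rw [e]
  rw [intervalIntegral.integral_const_mul, intervalIntegral.integral_comp_mul_sub
    (fun t => (legendrePoly i).eval t * (legendrePoly j).eval t) two_ne_zero]
  norm_num
  split_ifs with h
  · subst h
    simp_rw [← sq, integral_legendrePoly_sq]
    rw [Real.sq_sqrt (by positivity)]
    field_simp
  · rw [integral_legendrePoly_mul_of_ne h]
    simp

/-- A multiple of the arcsine density dominating the normalised kernels `k⁻¹ ∑_{j ≤ k} φ_j²`. -/
def arcsineBound (x : ℝ) : ℝ := 1.15 / √(1 - (2 * x - 1) ^ 2)

theorem measurable_arcsineBound : Measurable arcsineBound := by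
  unfold arcsineBound
  fun_prop

theorem sum_legendre_sq_le {k : ℕ} (hk : 200 ≤ k) {x : ℝ} (hx : x ∈ Set.Ioo (0 : ℝ) 1) :
    ∑ j ∈ Finset.Icc 1 k, legendre j x ^ 2 ≤ k * arcsineBound x := by
  have hw : 0 < 1 - (2 * x - 1) ^ 2 := by nlinarith [mul_pos hx.1 (sub_pos.mpr hx.2)]
  have h := sqrt_mul_sum_legendrePoly_sq_le hk (t := 2 * x - 1)
    ⟨by linarith [hx.1], by linarith [hx.2]⟩
  have hs := Real.sqrt_pos.mpr hw
  rw [arcsineBound, mul_div_assoc', le_div_iff₀ hs]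
  refine le_trans ?_ (h.trans_eq (mul_comm _ _))
  rw [mul_comm]
  gcongr
  calc ∑ j ∈ Finset.Icc 1 k, legendre j x ^ 2
      = ∑ j ∈ Finset.Icc 1 k, (2 * (j : ℝ) + 1) * (legendrePoly j).eval (2 * x - 1) ^ 2 := by
        refine Finset.sum_congr rfl fun j _ => ?_
        rw [legendre_eq, mul_pow, Real.sq_sqrt (by positivity)]
    _ ≤ _ := by
        refine Finset.sum_le_sum_of_subset_of_nonneg (fun j hj => ?_) fun j _ _ => by positivity
        rw [Finset.mem_Icc] at hj
        rw [Finset.mem_range]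
        omega

theorem hasDerivAt_arcsin_two_mul_sub_one {x : ℝ} (hx : x ∈ Set.Ioo (0 : ℝ) 1) :
    HasDerivAt (fun x => 1.15 / 2 * Real.arcsin (2 * x - 1)) (arcsineBound x) x := by
  have h1 : HasDerivAt (fun x : ℝ => 2 * x - 1) 2 x := by
    simpa using ((hasDerivAt_id x).const_mul 2).sub_const 1
  have h2 := (Real.hasDerivAt_arcsin (x := 2 * x - 1) (by linarith [hx.1])
    (by linarith [hx.2])).comp x h1
  refine (h2.const_mul (1.15 / 2)).congr_deriv ?_
  rw [arcsineBound]
  ring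

theorem arcsineBound_nonneg (x : ℝ) : 0 ≤ arcsineBound x := by
  unfold arcsineBound
  positivity

theorem intervalIntegrable_arcsineBound : IntervalIntegrable arcsineBound volume 0 1 := by
  rw [intervalIntegrable_iff_integrableOn_Ioc_of_le zero_le_one]
  exact intervalIntegral.integrableOn_deriv_of_nonneg
    (g := fun x => 1.15 / 2 * Real.arcsin (2 * x - 1)) (by fun_prop)
    (fun x hx => hasDerivAt_arcsin_two_mul_sub_one hx) fun x _ => arcsineBound_nonneg x

/-- The integral is `1.15 π/2`. The gap between 1.85 and 2 pays for rounding dimensions up to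
squares. -/
theorem integral_arcsineBound_lt : ∫ x in (0 : ℝ)..1, arcsineBound x < 1.85 := by
  rw [intervalIntegral.integral_eq_sub_of_hasDerivAt_of_le zero_le_one
    (f := fun x => 1.15 / 2 * Real.arcsin (2 * x - 1)) (by fun_prop)
    (fun x hx => hasDerivAt_arcsin_two_mul_sub_one hx) intervalIntegrable_arcsineBound]
  norm_num
  linarith [Real.pi_lt_d2]

/-! ### Functions of a uniform observation -/

section Uniform

variable {Ω : Type*} [MeasurableSpace Ω] {P : Measure Ω} {Y : Ω → ℝ}

theorem map_eq_restrict_of_isUniform (h : pdf.IsUniform Y (Set.Icc (0 : ℝ) 1) P) :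
    P.map Y = volume.restrict (Set.Icc (0 : ℝ) 1) := by
  rw [show P.map Y = _ from h, ProbabilityTheory.cond]
  simp

theorem integral_comp_of_isUniform (hY : Measurable Y)
    (h : pdf.IsUniform Y (Set.Icc (0 : ℝ) 1) P) {f : ℝ → ℝ} (hf : Measurable f) :
    ∫ ω, f (Y ω) ∂P = ∫ x in (0 : ℝ)..1, f x := by
  rw [← integral_map hY.aemeasurable hf.aestronglyMeasurable, map_eq_restrict_of_isUniform h,
    intervalIntegral.integral_of_le zero_le_one, integral_Icc_eq_integral_Ioc]

theorem integrable_comp_of_isUniform (hY : Measurable Y)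
    (h : pdf.IsUniform Y (Set.Icc (0 : ℝ) 1) P) {f : ℝ → ℝ} (hf : Measurable f)
    (hfi : IntervalIntegrable f volume 0 1) : Integrable (fun ω => f (Y ω)) P := by
  refine (integrable_map_measure (f := Y) hf.aestronglyMeasurable hY.aemeasurable).mp ?_
  rw [map_eq_restrict_of_isUniform h]
  rwa [intervalIntegrable_iff_integrableOn_Icc_of_le zero_le_one] at hfi

theorem ae_mem_Ioo_of_isUniform (hY : Measurable Y)
    (h : pdf.IsUniform Y (Set.Icc (0 : ℝ) 1) P) : ∀ᵐ ω ∂P, Y ω ∈ Set.Ioo (0 : ℝ) 1 := by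
  refine ae_of_ae_map hY.aemeasurable ?_
  rw [map_eq_restrict_of_isUniform h, ← restrict_Ioo_eq_restrict_Icc]
  exact ae_restrict_mem measurableSet_Ioo

theorem memLp_top_comp_of_isUniform (hY : Measurable Y)
    (h : pdf.IsUniform Y (Set.Icc (0 : ℝ) 1) P) {f : ℝ → ℝ} (hf : Continuous f) :
    MemLp (fun ω => f (Y ω)) ⊤ P := by
  obtain ⟨C, hC⟩ := isCompact_Icc.exists_bound_of_continuousOn (s := Set.Icc (0 : ℝ) 1)
    hf.continuousOn
  refine memLp_top_of_bound (hf.measurable.comp hY).aestronglyMeasurable C ?_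
  filter_upwards [ae_mem_Ioo_of_isUniform hY h] with ω hω
  exact hC _ (Set.Ioo_subset_Icc_self hω)

end Uniform

/-! ### Diagonal splitting and second moments -/

section Moments

variable {Ω : Type*}

/-- The sum of the `j`-th Legendre polynomial over the first `n` observations. -/
def score (X : ℕ → Ω → ℝ) (j n : ℕ) (ω : Ω) : ℝ := ∑ i ∈ Finset.range n, legendre j (X i ω)

/-- The off-diagonal part `∑_{i < l < n} ∑_{j ≤ k} φ_j(X_i) φ_j(X_l)`. -/
def cross (X : ℕ → Ω → ℝ) (k n : ℕ) (ω : Ω) : ℝ :=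
  ∑ l ∈ Finset.range n, ∑ j ∈ Finset.Icc 1 k, legendre j (X l ω) * score X j l ω

theorem score_succ (X : ℕ → Ω → ℝ) (j n : ℕ) (ω : Ω) :
    score X j (n + 1) ω = score X j n ω + legendre j (X n ω) := Finset.sum_range_succ _ _

theorem cross_succ (X : ℕ → Ω → ℝ) (k n : ℕ) (ω : Ω) :
    cross X k (n + 1) ω =
      cross X k n ω + ∑ j ∈ Finset.Icc 1 k, legendre j (X n ω) * score X j n ω :=
  Finset.sum_range_succ _ _

theorem sum_score_sq (X : ℕ → Ω → ℝ) (k n : ℕ) (ω : Ω) :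
    ∑ j ∈ Finset.Icc 1 k, score X j n ω ^ 2 =
      ∑ i ∈ Finset.range n, ∑ j ∈ Finset.Icc 1 k, legendre j (X i ω) ^ 2 +
        2 * cross X k n ω := by
  induction n with
  | zero => simp [score, cross]
  | succ n ih =>
    rw [Finset.sum_range_succ, cross_succ, mul_add, Finset.mul_sum]
    simp_rw [score_succ, add_sq]
    rw [Finset.sum_add_distrib, Finset.sum_add_distrib, ih]
    have : ∑ j ∈ Finset.Icc 1 k, 2 * score X j n ω * legendre j (X n ω) =
        ∑ j ∈ Finset.Icc 1 k, 2 * (legendre j (X n ω) * score X j n ω) :=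
      Finset.sum_congr rfl fun j _ => by ring
    rw [this]
    ring

theorem statistic_eq (X : ℕ → Ω → ℝ) (n k : ℕ) (ω : Ω) :
    statistic X n k ω = (∑ j ∈ Finset.Icc 1 k, score X j n ω ^ 2) / n := by
  rw [statistic, Finset.sum_div]
  refine Finset.sum_congr rfl fun j _ => ?_
  rw [mul_pow, div_pow, Real.sq_sqrt (Nat.cast_nonneg n), one_pow, score]
  ring

theorem statistic_nonneg (X : ℕ → Ω → ℝ) (n k : ℕ) (ω : Ω) : 0 ≤ statistic X n k ω :=
  Finset.sum_nonneg fun _ _ => sq_nonneg _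

theorem statistic_mono (X : ℕ → Ω → ℝ) (n : ℕ) (ω : Ω) : Monotone fun k => statistic X n k ω :=
  fun _ _ h => Finset.sum_le_sum_of_subset_of_nonneg (Finset.Icc_subset_Icc_right h)
    fun _ _ _ => sq_nonneg _

/-- The `σ`-algebra generated by the first `n` observations. -/
abbrev pastSigma (X : ℕ → Ω → ℝ) (n : ℕ) : MeasurableSpace Ω :=
  ⨆ i ∈ Set.Iio n, MeasurableSpace.comap (X i) inferInstance

theorem measurable_pastSigma (X : ℕ → Ω → ℝ) {i n : ℕ} (h : i < n) :
    Measurable[pastSigma X n] (X i) :=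
  Measurable.mono (comap_measurable (X i))
    (le_iSup₂ (f := fun i (_ : i ∈ Set.Iio n) => MeasurableSpace.comap (X i) inferInstance) i h)
    le_rfl

theorem measurable_pastSigma_score (X : ℕ → Ω → ℝ) (j : ℕ) {m n : ℕ} (h : m ≤ n) :
    Measurable[pastSigma X n] (score X j m) :=
  Finset.measurable_fun_sum _ fun _ hi => (continuous_legendre j).measurable.comp
    (measurable_pastSigma X ((Finset.mem_range.mp hi).trans_le h))

theorem measurable_pastSigma_cross (X : ℕ → Ω → ℝ) (k n : ℕ) :
    Measurable[pastSigma X n] (cross X k n) :=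
  Finset.measurable_fun_sum _ fun _ hl => Finset.measurable_fun_sum _ fun j _ =>
    ((continuous_legendre j).measurable.comp
      (measurable_pastSigma X (Finset.mem_range.mp hl))).mul
      (measurable_pastSigma_score X j (Finset.mem_range.mp hl).le)

variable [MeasurableSpace Ω] {P : Measure Ω} {X : ℕ → Ω → ℝ}

theorem integral_mul_past (hXm : ∀ i, Measurable (X i)) (hX : iIndepFun X P) (n : ℕ)
    {g : ℝ → ℝ} (hg : Measurable g) {A : Ω → ℝ} (hA : Measurable[pastSigma X n] A) :
    ∫ ω, g (X n ω) * A ω ∂P = (∫ ω, g (X n ω) ∂P) * ∫ ω, A ω ∂P := by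
  have hle : pastSigma X n ≤ ‹MeasurableSpace Ω› := iSup₂_le fun i _ => (hXm i).comap_le
  have hi : Indep (⨆ i ∈ ({n} : Set ℕ), MeasurableSpace.comap (X i) inferInstance)
      (pastSigma X n) P :=
    indep_iSup_of_disjoint (fun i => (hXm i).comap_le) hX (by simp)
  rw [iSup_singleton] at hi
  have hind : IndepFun (fun ω => g (X n ω)) A P := by
    rw [IndepFun_iff_Indep]
    refine indep_of_indep_of_le_left (indep_of_indep_of_le_right hi hA.comap_le) ?_
    exact (hg.comp (comap_measurable (X n))).comap_le
  exact hind.integral_mul_eq_mul_integral (hg.comp (hXm n)).aestronglyMeasurable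
    (hA.mono hle le_rfl).aestronglyMeasurable

theorem memLp_top_score (hXm : ∀ i, Measurable (X i))
    (hXunif : ∀ i, pdf.IsUniform (X i) (Set.Icc (0 : ℝ) 1) P) (j n : ℕ) :
    MemLp (score X j n) ⊤ P :=
  memLp_finsetSum _ fun i _ =>
    memLp_top_comp_of_isUniform (hXm i) (hXunif i) (continuous_legendre j)

theorem memLp_top_cross (hXm : ∀ i, Measurable (X i))
    (hXunif : ∀ i, pdf.IsUniform (X i) (Set.Icc (0 : ℝ) 1) P) (k n : ℕ) :
    MemLp (cross X k n) ⊤ P :=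
  memLp_finsetSum _ fun l _ => memLp_finsetSum _ fun j _ =>
    (memLp_top_score hXm hXunif j l).mul'
      (memLp_top_comp_of_isUniform (hXm l) (hXunif l) (continuous_legendre j))

theorem integral_legendre_mul_legendre_comp (hXm : ∀ i, Measurable (X i))
    (hXunif : ∀ i, pdf.IsUniform (X i) (Set.Icc (0 : ℝ) 1) P) (i j n : ℕ) :
    ∫ ω, legendre i (X n ω) * legendre j (X n ω) ∂P = if i = j then 1 else 0 := by
  rw [← integral_legendre_mul_legendre i j]
  exact integral_comp_of_isUniform (hXm n) (hXunif n)
    (f := fun x => legendre i x * legendre j x)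
    ((continuous_legendre i).mul (continuous_legendre j)).measurable

theorem integral_legendre_comp (hXm : ∀ i, Measurable (X i))
    (hXunif : ∀ i, pdf.IsUniform (X i) (Set.Icc (0 : ℝ) 1) P) {j : ℕ} (hj : 1 ≤ j) (n : ℕ) :
    ∫ ω, legendre j (X n ω) ∂P = 0 := by
  have h := integral_legendre_mul_legendre_comp hXm hXunif j 0 n
  rw [if_neg (by omega)] at h
  simpa [legendre_zero] using h

variable [IsProbabilityMeasure P]

theorem integral_score_sq (hXm : ∀ i, Measurable (X i)) (hX : iIndepFun X P)
    (hXunif : ∀ i, pdf.IsUniform (X i) (Set.Icc (0 : ℝ) 1) P) {j : ℕ} (hj : 1 ≤ j) (n : ℕ) :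
    ∫ ω, score X j n ω ^ 2 ∂P = n := by
  induction n with
  | zero => simp [score]
  | succ n ih =>
    have hs := memLp_top_score hXm hXunif j n
    have hl := memLp_top_comp_of_isUniform (hXm n) (hXunif n) (continuous_legendre j)
    have h1 : Integrable (fun ω => score X j n ω ^ 2) P := by
      simpa only [sq] using (hs.mul' hs (r := ⊤)).integrable le_top
    have h2 : Integrable (fun ω => legendre j (X n ω) * score X j n ω) P :=
      (hs.mul' hl (r := ⊤)).integrable le_top
    have h3 : Integrable (fun ω => legendre j (X n ω) * legendre j (X n ω)) P :=
      (hl.mul' hl (r := ⊤)).integrable le_top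
    calc ∫ ω, score X j (n + 1) ω ^ 2 ∂P
        = ∫ ω, (score X j n ω ^ 2 + 2 * (legendre j (X n ω) * score X j n ω) +
            legendre j (X n ω) * legendre j (X n ω)) ∂P := by
          refine integral_congr_ae (Eventually.of_forall fun ω => ?_)
          simp only [score_succ]
          ring
      _ = ((n + 1 : ℕ) : ℝ) := by
          rw [integral_add (h1.fun_add (h2.const_mul 2)) h3, integral_add h1 (h2.const_mul 2), ih,
            integral_const_mul, integral_mul_past hXm hX n (continuous_legendre j).measurable
              (measurable_pastSigma_score X j le_rfl), integral_legendre_comp hXm hXunif hj,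
            integral_legendre_mul_legendre_comp hXm hXunif]
          simp

/-- `cross` is a martingale in `n`: by independence from the past, its increment is centred and
orthogonal to it. Orthonormality leaves `∑_{j ≤ k} E[score_j²] = k n` as the second moment of the
increment. -/
theorem integral_cross_sq (hXm : ∀ i, Measurable (X i)) (hX : iIndepFun X P)
    (hXunif : ∀ i, pdf.IsUniform (X i) (Set.Icc (0 : ℝ) 1) P) (k n : ℕ) :
    ∫ ω, cross X k n ω ^ 2 ∂P = n * (n - 1) / 2 * k := by
  induction n with
  | zero => simp [cross]
  | succ n ih =>
    have hc := memLp_top_cross hXm hXunif k n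
    have hs := fun j => memLp_top_score hXm hXunif j n
    have hl := fun j => memLp_top_comp_of_isUniform (hXm n) (hXunif n) (continuous_legendre j)
    have h1 : Integrable (fun ω => cross X k n ω ^ 2) P := by
      simpa only [sq] using (hc.mul' hc (r := ⊤)).integrable le_top
    have h2 : ∀ j, Integrable
        (fun ω => legendre j (X n ω) * (score X j n ω * cross X k n ω)) P := fun j =>
      ((hc.mul' (hs j) (r := ⊤)).mul' (hl j) (r := ⊤)).integrable le_top
    have h3 : ∀ i j, Integrable (fun ω => (legendre i (X n ω) * legendre j (X n ω)) *
        (score X i n ω * score X j n ω)) P := fun i j =>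
      (((hs j).mul' (hs i) (r := ⊤)).mul' ((hl j).mul' (hl i) (r := ⊤)) (r := ⊤)).integrable le_top
    calc ∫ ω, cross X k (n + 1) ω ^ 2 ∂P
        = ∫ ω, (cross X k n ω ^ 2 +
            2 * (∑ j ∈ Finset.Icc 1 k, legendre j (X n ω) * (score X j n ω * cross X k n ω)) +
            ∑ i ∈ Finset.Icc 1 k, ∑ j ∈ Finset.Icc 1 k,
              (legendre i (X n ω) * legendre j (X n ω)) * (score X i n ω * score X j n ω)) ∂P := by
          refine integral_congr_ae (Eventually.of_forall fun ω => ?_)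
          simp only [cross_succ, add_sq]
          congr 1
          · rw [mul_assoc, Finset.mul_sum]
            simp only [mul_comm, mul_left_comm]
          · rw [sq, Finset.sum_mul_sum]
            exact Finset.sum_congr rfl fun i _ => Finset.sum_congr rfl fun j _ => by ring
      _ = n * (n - 1) / 2 * k + 2 * (∑ j ∈ Finset.Icc 1 k, 0) +
            ∑ i ∈ Finset.Icc 1 k, ∑ j ∈ Finset.Icc 1 k,
              (if i = j then 1 else 0) * ∫ ω, score X i n ω * score X j n ω ∂P := by
          have i2 := (integrable_finsetSum (Finset.Icc 1 k) fun j _ => h2 j).const_mul 2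
          have i3 := integrable_finsetSum (Finset.Icc 1 k) fun i _ =>
            integrable_finsetSum (Finset.Icc 1 k) fun j _ => h3 i j
          rw [integral_add (h1.fun_add i2) i3, integral_add h1 i2, ih, integral_const_mul,
            integral_finsetSum _ fun j _ => h2 j, integral_finsetSum _ fun i _ =>
              integrable_finsetSum (Finset.Icc 1 k) fun j _ => h3 i j]
          congr 1
          · congr 2
            refine Finset.sum_congr rfl fun j hj => ?_
            rw [integral_mul_past hXm hX n (continuous_legendre j).measurable
              (A := fun ω => score X j n ω * cross X k n ω)
              ((measurable_pastSigma_score X j le_rfl).mul (measurable_pastSigma_cross X k n)),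
              integral_legendre_comp hXm hXunif (Finset.mem_Icc.mp hj).1, zero_mul]
          · refine Finset.sum_congr rfl fun i _ => ?_
            rw [integral_finsetSum _ fun j _ => h3 i j]
            refine Finset.sum_congr rfl fun j _ => ?_
            rw [integral_mul_past hXm hX n (g := fun x => legendre i x * legendre j x)
              ((continuous_legendre i).mul (continuous_legendre j)).measurable
              (A := fun ω => score X i n ω * score X j n ω)
              ((measurable_pastSigma_score X i le_rfl).mul
                (measurable_pastSigma_score X j le_rfl)),
              integral_legendre_mul_legendre_comp hXm hXunif]
      _ = n * (n - 1) / 2 * k + k * n := by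
          simp only [ite_mul, one_mul, zero_mul, Finset.sum_ite_eq, Finset.sum_const_zero,
            mul_zero, add_zero]
          congr 1
          rw [Finset.sum_congr rfl (g := fun _ => (n : ℝ))]
          · simp
          · intro i hi
            rw [if_pos hi, ← integral_score_sq hXm hX hXunif (Finset.mem_Icc.mp hi).1 n]
            simp only [sq]
      _ = _ := by
          push_cast
          ring

end Moments

/-! ### Tightness of the selected dimension -/

section Selection

variable {Ω : Type*}

theorem selectionRule_spec (X : ℕ → Ω → ℝ) {d : ℕ → ℕ} (pen : ℕ → ℕ → ℝ) {n : ℕ}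
    (hd : 1 ≤ d n) (ω : Ω) :
    1 ≤ selectionRule X d pen n ω ∧ selectionRule X d pen n ω ≤ d n ∧
      ∀ j, 1 ≤ j → j ≤ d n → statistic X n j ω - pen j n ≤
        statistic X n (selectionRule X d pen n ω) ω - pen (selectionRule X d pen n ω) n := by
  refine Nat.sInf_mem (s := {k : ℕ | 1 ≤ k ∧ k ≤ d n ∧ ∀ j, 1 ≤ j → j ≤ d n →
    statistic X n j ω - pen j n ≤ statistic X n k ω - pen k n}) ?_
  obtain ⟨k, hk, hmax⟩ := (Finset.Icc 1 (d n)).exists_max_image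
    (fun k => statistic X n k ω - pen k n) ⟨1, by simpa using hd⟩
  rw [Finset.mem_Icc] at hk
  exact ⟨k, hk.1, hk.2, fun j h1 h2 => hmax j (Finset.mem_Icc.mpr ⟨h1, h2⟩)⟩

/-- A dimension larger than one is selected only if its statistic exceeds twice the dimension. -/
theorem two_mul_selectionRule_le_statistic (X : ℕ → Ω → ℝ) {d : ℕ → ℕ} {pen : ℕ → ℕ → ℝ} {n : ℕ}
    (hd : 1 ≤ d n) (hpen : ∀ k, 2 ≤ k → k ≤ d n → 2 * (k : ℝ) ≤ pen k n - pen 1 n) {ω : Ω}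
    (hS : 2 ≤ selectionRule X d pen n ω) :
    2 * (selectionRule X d pen n ω : ℝ) ≤ statistic X n (selectionRule X d pen n ω) ω := by
  obtain ⟨-, hle, hmax⟩ := selectionRule_spec X pen hd ω
  have h1 := hmax 1 le_rfl hd
  have h2 := hpen _ hS hle
  have h3 := statistic_nonneg X n 1 ω
  linarith

theorem statistic_le_of_forall_mem_Ioo (X : ℕ → Ω → ℝ) {n k : ℕ} (hk : 200 ≤ k) {ω : Ω}
    (hω : ∀ i, X i ω ∈ Set.Ioo (0 : ℝ) 1) :
    statistic X n k ω ≤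
      k * ((∑ i ∈ Finset.range n, arcsineBound (X i ω)) / n) + 2 * cross X k n ω / n := by
  rw [statistic_eq, sum_score_sq, mul_div_assoc', ← add_div]
  gcongr
  rw [Finset.mul_sum]
  exact Finset.sum_le_sum fun i _ => sum_legendre_sq_le hk (hω i)

/-- Round `k` up to the square of `m = √k + 1` (integer root) and use monotonicity of the statistic.
The shift `l + L` indexes the tail of a series. -/
theorem exists_cross_ge {X : ℕ → Ω → ℝ} {n k L : ℕ} (hn : 1 ≤ n) (hL : 100 ≤ L) (hk : L ^ 2 < k)
    {ω : Ω} (hω : ∀ i, X i ω ∈ Set.Ioo (0 : ℝ) 1) (hT : 2 * (k : ℝ) ≤ statistic X n k ω)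
    (havg : (∑ i ∈ Finset.range n, arcsineBound (X i ω)) / n < 1.85) :
    ∃ l, (n : ℝ) * ((l + L : ℕ) : ℝ) ^ 2 / 20 ≤ cross X ((l + L) ^ 2) n ω := by
  have hs1 : L ≤ Nat.sqrt k := Nat.le_sqrt'.mpr hk.le
  obtain ⟨l, hl⟩ : ∃ l, Nat.sqrt k + 1 = l + L := ⟨Nat.sqrt k + 1 - L, by omega⟩
  refine ⟨l, ?_⟩
  have hklt : k < (l + L) ^ 2 := hl ▸ Nat.lt_succ_sqrt' k
  have hkge : (Nat.sqrt k) ^ 2 ≤ k := Nat.sqrt_le' k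
  set m := l + L
  have hm : (100 : ℝ) ≤ m := by
    have : 100 ≤ m := by omega
    exact_mod_cast this
  have hkge' : ((m : ℝ) - 1) ^ 2 ≤ k := by
    have : (m : ℝ) - 1 = Nat.sqrt k := by rw [← hl]; push_cast; ring
    rw [this]
    exact_mod_cast hkge
  have hm2 : 200 ≤ m ^ 2 := by
    have : 100 ≤ m := by omega
    nlinarith
  have h1 := statistic_le_of_forall_mem_Ioo X (n := n) hm2 hω
  have h2 : statistic X n k ω ≤ statistic X n (m ^ 2) ω := statistic_mono X n ω hklt.le
  have hn' : (0 : ℝ) < n := by exact_mod_cast hn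
  have h3 : ((m ^ 2 : ℕ) : ℝ) * ((∑ i ∈ Finset.range n, arcsineBound (X i ω)) / n) ≤
      (m : ℝ) ^ 2 * 1.85 := by
    push_cast
    gcongr
  -- For `m ≥ 100`, `2(m-1)² ≥ 1.96 m²`, which exceeds the diagonal bound `1.85 m²` by at least `0.1
  -- m²`.
  have h4 : (m : ℝ) ^ 2 * 0.1 ≤ 2 * cross X (m ^ 2) n ω / n := by nlinarith
  rw [le_div_iff₀ hn'] at h4
  linarith

variable [MeasurableSpace Ω] {P : Measure Ω} [IsProbabilityMeasure P] {X : ℕ → Ω → ℝ}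

/-- Chebyshev's inequality in dimension `l²`; the bound is summable in `l` and free of `n`. -/
theorem measure_cross_ge_le (hXm : ∀ i, Measurable (X i)) (hX : iIndepFun X P)
    (hXunif : ∀ i, pdf.IsUniform (X i) (Set.Icc (0 : ℝ) 1) P) {n l : ℕ} (hn : 1 ≤ n)
    (hl : 1 ≤ l) :
    P {ω | (n : ℝ) * (l : ℝ) ^ 2 / 20 ≤ cross X (l ^ 2) n ω} ≤
      ENNReal.ofReal (200 / (l : ℝ) ^ 2) := by
  have hn' : (0 : ℝ) < n := by exact_mod_cast hn
  have hl' : (0 : ℝ) < l := by exact_mod_cast hl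
  have hc := memLp_top_cross hXm hXunif (l ^ 2) n
  have hint : Integrable (fun ω => cross X (l ^ 2) n ω ^ 2) P := by
    simpa only [sq] using (hc.mul' hc (r := ⊤)).integrable le_top
  have h := mul_meas_ge_le_integral_of_nonneg (Eventually.of_forall fun ω => sq_nonneg _) hint
    (((n : ℝ) * (l : ℝ) ^ 2 / 20) ^ 2)
  rw [integral_cross_sq hXm hX hXunif] at h
  refine (measure_mono (t := {ω | ((n : ℝ) * (l : ℝ) ^ 2 / 20) ^ 2 ≤
    cross X (l ^ 2) n ω ^ 2}) fun ω hω => ?_).trans ?_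
  · rw [Set.mem_ofPred_eq] at hω ⊢
    exact pow_le_pow_left₀ (by positivity) hω 2
  rw [← ofReal_measureReal]
  apply ENNReal.ofReal_le_ofReal
  set p := P.real {ω | ((n : ℝ) * (l : ℝ) ^ 2 / 20) ^ 2 ≤ cross X (l ^ 2) n ω ^ 2}
  rw [le_div_iff₀ (by positivity)]
  refine le_of_mul_le_mul_left ?_ (by positivity : 0 < (n : ℝ) ^ 2 * (l : ℝ) ^ 2)
  push_cast at h
  nlinarith [mul_pos hn' (pow_pos hl' 2)]

theorem tendsto_measure_arcsineBound_average (hXm : ∀ i, Measurable (X i)) (hX : iIndepFun X P)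
    (hXunif : ∀ i, pdf.IsUniform (X i) (Set.Icc (0 : ℝ) 1) P) :
    Tendsto (fun n : ℕ =>
      P {ω | 1.85 ≤ (∑ i ∈ Finset.range n, arcsineBound (X i ω)) / n}) atTop (𝓝 0) := by
  have hG := measurable_arcsineBound
  have hlaw := strong_law_ae_real (μ := P) (fun i ω => arcsineBound (X i ω))
    (integrable_comp_of_isUniform (hXm 0) (hXunif 0) hG intervalIntegrable_arcsineBound)
    (fun i j hij => (hX.indepFun hij).comp hG hG)
    (fun i => IdentDistrib.comp (f := X i) (g := X 0) (u := arcsineBound)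
      ⟨(hXm i).aemeasurable, (hXm 0).aemeasurable, by
      rw [map_eq_restrict_of_isUniform (hXunif i), map_eq_restrict_of_isUniform (hXunif 0)]⟩ hG)
  have hmeas := tendstoInMeasure_of_tendsto_ae (fun n : ℕ =>
    ((Finset.measurable_fun_sum (Finset.range n) fun i _ =>
      hG.comp (hXm i)).div_const (n : ℝ)).aestronglyMeasurable) hlaw
  rw [integral_comp_of_isUniform (hXm 0) (hXunif 0) hG] at hmeas
  rw [tendstoInMeasure_iff_dist] at hmeas
  refine tendsto_of_tendsto_of_tendsto_of_le_of_le tendsto_const_nhds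
    (hmeas _ (sub_pos.mpr integral_arcsineBound_lt)) (fun _ => zero_le) fun n => ?_
  refine measure_mono fun ω hω => ?_
  simp only [Set.mem_ofPred_eq] at hω ⊢
  rw [Real.dist_eq]
  exact le_trans (by simpa using hω) (le_abs_self _)

/-- Tightness of the selected dimension. No growth condition on `d` enters: the pointwise bound
`sum_legendre_sq_le` controls the diagonal part of the statistics of all dimensions at once. -/
theorem exists_measure_selectionRule_gt_le (hXm : ∀ i, Measurable (X i)) (hX : iIndepFun X P)
    (hXunif : ∀ i, pdf.IsUniform (X i) (Set.Icc (0 : ℝ) 1) P) {d : ℕ → ℕ} (hd : ∀ n, 1 ≤ d n)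
    {pen : ℕ → ℕ → ℝ}
    (hpen : ∀ᶠ n in atTop, ∀ k, 2 ≤ k → k ≤ d n → 2 * (k : ℝ) ≤ pen k n - pen 1 n)
    {ε : ℝ} (hε : 0 < ε) :
    ∃ K : ℕ, ∀ᶠ n in atTop, P {ω | K < selectionRule X d pen n ω} ≤ ENNReal.ofReal ε := by
  have hε2 : 0 < ENNReal.ofReal (ε / 2) := ENNReal.ofReal_pos.mpr (half_pos hε)
  have hsum : ∑' l : ℕ, ENNReal.ofReal (200 / (l : ℝ) ^ 2) ≠ ⊤ := by
    have : Summable fun l : ℕ => 200 / (l : ℝ) ^ 2 := by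
      simpa [div_eq_mul_inv] using
        (Real.summable_nat_pow_inv.mpr (by norm_num : 1 < 2)).mul_left 200
    rw [← ENNReal.ofReal_tsum_of_nonneg (fun l => by positivity) this]
    exact ENNReal.ofReal_ne_top
  obtain ⟨L, hL, hL100⟩ := ((ENNReal.tendsto_sum_nat_add _ hsum).eventually_le_const hε2
    |>.and (eventually_ge_atTop 100)).exists
  refine ⟨L ^ 2, ?_⟩
  filter_upwards [hpen, eventually_ge_atTop 1,
    (tendsto_measure_arcsineBound_average hXm hX hXunif).eventually_le_const hε2]
    with n hpn hn havg
  have hae : P {ω | ∀ i, X i ω ∈ Set.Ioo (0 : ℝ) 1}ᶜ = 0 :=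
    ae_all_iff.mpr fun i => ae_mem_Ioo_of_isUniform (hXm i) (hXunif i)
  have hsub : {ω | L ^ 2 < selectionRule X d pen n ω} ⊆ {ω | ∀ i, X i ω ∈ Set.Ioo (0 : ℝ) 1}ᶜ ∪
      ({ω | 1.85 ≤ (∑ i ∈ Finset.range n, arcsineBound (X i ω)) / n} ∪
        ⋃ l : ℕ, {ω | (n : ℝ) * ((l + L : ℕ) : ℝ) ^ 2 / 20 ≤ cross X ((l + L) ^ 2) n ω}) := by
    intro ω hω
    by_contra hc
    simp only [Set.mem_union, not_or, Set.mem_compl_iff, not_not, Set.mem_ofPred_eq, not_le,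
      Set.mem_iUnion, not_exists] at hc
    obtain ⟨h1, h2, h3⟩ := hc
    have hS : 2 ≤ selectionRule X d pen n ω := by
      have : L ^ 2 < selectionRule X d pen n ω := hω
      nlinarith
    obtain ⟨l, hl⟩ := exists_cross_ge hn hL100 hω h1
      (two_mul_selectionRule_le_statistic X (hd n) hpn hS) h2
    exact absurd hl (not_le.mpr (h3 l))
  calc P {ω | L ^ 2 < selectionRule X d pen n ω}
      ≤ 0 + (ENNReal.ofReal (ε / 2) + ENNReal.ofReal (ε / 2)) := by
        refine (measure_mono hsub).trans ((measure_union_le _ _).trans ?_)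
        refine add_le_add hae.le ((measure_union_le _ _).trans (add_le_add havg ?_))
        refine (measure_iUnion_le _).trans (le_trans (ENNReal.tsum_le_tsum fun l => ?_) hL)
        exact measure_cross_ge_le hXm hX hXunif hn (by omega)
    _ = ENNReal.ofReal ε := by
        rw [zero_add, ← ENNReal.ofReal_add (half_pos hε).le (half_pos hε).le, add_halves]

theorem measure_statistic_gt_le (hXm : ∀ i, Measurable (X i)) (hX : iIndepFun X P)
    (hXunif : ∀ i, pdf.IsUniform (X i) (Set.Icc (0 : ℝ) 1) P) {n : ℕ} (hn : 1 ≤ n) (k : ℕ)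
    {C : ℝ} (hC : 0 < C) :
    P {ω | C < statistic X n k ω} ≤ ENNReal.ofReal (k / C) := by
  have hn' : (n : ℝ) ≠ 0 := by positivity
  have hs : ∀ j, Integrable (fun ω => score X j n ω ^ 2) P := fun j => by
    have := memLp_top_score hXm hXunif j n
    simpa only [sq] using (this.mul' this (r := ⊤)).integrable le_top
  have hint : Integrable (statistic X n k) P := by
    rw [show statistic X n k = fun ω => (∑ j ∈ Finset.Icc 1 k, score X j n ω ^ 2) / n from
      funext (statistic_eq X n k)]
    exact (integrable_finsetSum _ fun j _ => hs j).div_const _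
  have hmean : ∫ ω, statistic X n k ω ∂P = k := by
    simp_rw [statistic_eq]
    rw [integral_div, integral_finsetSum _ fun j _ => hs j,
      Finset.sum_congr rfl fun j hj =>
        integral_score_sq hXm hX hXunif (Finset.mem_Icc.mp hj).1 n]
    simp [hn']
  have h := mul_meas_ge_le_integral_of_nonneg
    (Eventually.of_forall fun ω => statistic_nonneg X n k ω) hint C
  rw [hmean] at h
  refine (measure_mono (t := {ω | C ≤ statistic X n k ω}) fun ω hω => ?_).trans ?_
  · rw [Set.mem_ofPred_eq] at hω ⊢
    exact hω.le
  rw [← ofReal_measureReal]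
  apply ENNReal.ofReal_le_ofReal
  rw [le_div_iff₀ hC]
  linarith

end Selection

end NeymanTest

end

theorem mainTheorem8 {Ω : Type*} [MeasurableSpace Ω] (P : Measure Ω) [IsProbabilityMeasure P]
    (X : ℕ → Ω → ℝ) (hXm : ∀ i, Measurable (X i))
    (hXindep : iIndepFun X P)
    (hXunif : ∀ i, pdf.IsUniform (X i) (Set.Icc (0 : ℝ) 1) P)
    (d : ℕ → ℕ) (hd : ∀ n, 1 ≤ d n)
    (pen : ℕ → ℕ → ℝ) (hpen : NeymanTest.IsPenalty d pen)
    (hpen_ge : ∀ᶠ n in atTop, ∀ k, 2 ≤ k → k ≤ d n → 2 * (k : ℝ) ≤ pen k n - pen 1 n)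
    (hrate : Tendsto (fun n : ℕ => (d n : ℝ) * pen (d n) n / √(n : ℝ)) atTop (𝓝 0)) :
    NeymanTest.BoundedInProbability P
        (fun n ω => (NeymanTest.selectionRule X d pen n ω : ℝ)) ∧
      NeymanTest.BoundedInProbability P (NeymanTest.dataDrivenStatistic X d pen) := by
  refine ⟨fun ε hε => ?_, fun ε hε => ?_⟩
  · obtain ⟨K, hK⟩ :=
      NeymanTest.exists_measure_selectionRule_gt_le hXm hXindep hXunif hd hpen_ge hε
    refine ⟨K, hK.mono fun n hn => le_trans (measure_mono fun ω hω => ?_) hn⟩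
    simpa using hω
  · obtain ⟨K, hK⟩ :=
      NeymanTest.exists_measure_selectionRule_gt_le hXm hXindep hXunif hd hpen_ge (half_pos hε)
    -- `K + 1` rather than `K` keeps the threshold positive when `K = 0`.
    have hC : (0 : ℝ) < (K + 1) / (ε / 2) := by positivity
    refine ⟨(K + 1) / (ε / 2), ?_⟩
    filter_upwards [hK, eventually_ge_atTop 1] with n hn hn1
    have hT := NeymanTest.measure_statistic_gt_le hXm hXindep hXunif hn1 K hC
    calc P {ω | (K + 1) / (ε / 2) < |NeymanTest.dataDrivenStatistic X d pen n ω|}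
        ≤ P ({ω | K < NeymanTest.selectionRule X d pen n ω} ∪
            {ω | (K + 1) / (ε / 2) < NeymanTest.statistic X n K ω}) := by
          refine measure_mono fun ω hω => ?_
          by_cases hS : K < NeymanTest.selectionRule X d pen n ω
          · exact Or.inl hS
          · right
            rw [Set.mem_ofPred_eq, NeymanTest.dataDrivenStatistic,
              abs_of_nonneg (NeymanTest.statistic_nonneg ..)] at hω
            rw [Set.mem_ofPred_eq]
            exact hω.trans_le <| NeymanTest.statistic_mono X n ω (not_lt.mp hS)
      _ ≤ ENNReal.ofReal (ε / 2) + ENNReal.ofReal (ε / 2) := by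
          refine (measure_union_le _ _).trans (add_le_add hn (hT.trans ?_))
          apply ENNReal.ofReal_le_ofReal
          rw [div_le_iff₀ hC]
          field_simp
          linarith
      _ = ENNReal.ofReal ε := by
          rw [← ENNReal.ofReal_add (half_pos hε).le (half_pos hε).le, add_halves]
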